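/- Let $A$ be a complex unital Banach algebra that is primitive, i.e. there is a maximal left ideal $L$ of $A$ with $\{x\in A: xA\subseteq L\}=\{0\}$. Let $J=\operatorname{soc}(A)$ be the socle of $A$, that is, the sum of the minimal left ideals of $A$ (a two-sided ideal, equal to $\{0\}$ if there are no minimal left ideals). Let $p\in A$ be a minimal idempotent: $p\neq 0$, $p^2=p$ and $pAp=\mathbb{C}p$. Let $a\in A$ be a B-Fredholm element modulo $J$, that is, the image $\pi(a)$ of $a$ in $A/J$ is Drazin invertible: there are $b\in A/J$ and $k\in\mathbb{N}$ with $b\,\pi(a)\,b=b$, $\pi(a)b=b\,\pi(a)$ and $\pi(a)^k\,b\,\pi(a)=\pi(a)^k$. Then $Ap=\{xp: x\in A\}$ is a Banach space in the norm of $A$, and the operator $\widehat a: Ap\to Ap$, $\widehat a(y)=ay$, is a B-Fredholm operator: there is an integer $n\ge 0$ such that the range $R(\widehat a^{\,n})$ is closed and the operator $R(\widehat a^{\,n})\to R(\widehat a^{\,n})$ induced by $\widehat a$ is a Fredholm operator. -/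

import Mathlib

/-- An element `a` of a unital ring is Drazin invertible if there are `b` and `k : ℕ` with
`b a b = b`, `a b = b a` and `a ^ k b a = a ^ k`. -/
def IsDrazinInvertible {R : Type*} [Ring R] (a : R) : Prop :=
  ∃ (b : R) (k : ℕ), b * a * b = b ∧ a * b = b * a ∧ a ^ k * b * a = a ^ k

/-- `a` is a B-Fredholm element of `A` modulo the (two-sided) ideal `J` if its image in `A ⧸ J` is
Drazin invertible. -/
def IsBFredholmModulo {A : Type*} [Ring A] (J : Ideal A) [J.IsTwoSided] (a : A) : Prop :=
  IsDrazinInvertible (Ideal.Quotient.mk J a)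

/-- A unital ring is (left) primitive if `{0}` is a primitive ideal: there is a maximal left
ideal `L` with `{x | x A ⊆ L} = {0}`, that is, the simple left module `A ⧸ L` is faithful.
(`Ideal A` is the type of left ideals of `A`.) -/
def IsPrimitiveRing (A : Type*) [Ring A] : Prop :=
  ∃ L : Ideal A, L.IsMaximal ∧ ∀ x : A, (∀ y : A, x * y ∈ L) → x = 0

/-- The socle of a ring: the sum of its minimal left ideals (and `0` if there are none). In a
semiprime ring, in particular in a primitive one, it is also the sum of the minimal right
ideals. -/
def ringSocle (A : Type*) [Ring A] : Ideal A :=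
  sSup {L : Ideal A | IsAtom L}

instance ringSocle_isTwoSided (A : Type*) [Ring A] : (ringSocle A).IsTwoSided := by
  refine ⟨fun {a} b ha => ?_⟩
  suffices h : ringSocle A ≤ Submodule.comap (LinearMap.toSpanSingleton A A b) (ringSocle A) from h ha
  refine sSup_le fun L hL => ?_
  rw [← Submodule.map_le_iff_le_comap]
  have : IsSimpleModule A L := isSimpleModule_iff_isAtom.2 hL
  set f := LinearMap.toSpanSingleton A A b
  rcases LinearMap.injective_or_eq_zero (f.domRestrict L) with h | h
  · refine le_sSup ?_
    have e := LinearEquiv.ofInjective _ h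
    rw [LinearMap.range_domRestrict] at e
    exact isSimpleModule_iff_isAtom.1 (IsSimpleModule.congr e.symm)
  · have : Submodule.map f L = ⊥ := by rw [← LinearMap.range_domRestrict, h, LinearMap.range_zero]
    rw [this]
    exact bot_le

/-- A minimal idempotent of a complex unital algebra: a nonzero idempotent `p` with
`p A p = ℂ p`. -/
def IsMinimalIdempotent {A : Type*} [Ring A] [Algebra ℂ A] (p : A) : Prop :=
  p ≠ 0 ∧ p * p = p ∧ Set.range (fun x : A => p * x * p) = Set.range (fun c : ℂ => c • p)

/-- The subspace `A p = {x p | x ∈ A}` of `A`, with the norm of `A`. -/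
noncomputable def leftIdealSpace {A : Type*} [NormedRing A] [NormedAlgebra ℂ A] (p : A) : Submodule ℂ A :=
  LinearMap.range (LinearMap.mulRight ℂ p)

/-- The operator `y ↦ a y` of left multiplication by `a` on `A p`. -/
noncomputable def leftMulOperator {A : Type*} [NormedRing A] [NormedAlgebra ℂ A] (p a : A) :
    leftIdealSpace p →L[ℂ] leftIdealSpace p :=
  (ContinuousLinearMap.mul ℂ A a).restrict (p := leftIdealSpace p) (q := leftIdealSpace p)
    (by rintro _ ⟨x, rfl⟩; exact ⟨a * x, mul_assoc a x p⟩)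

/-- The operator `T_n : R(T ^ n) → R(T ^ n)` induced by `T` on the range of `T ^ n`. -/
noncomputable def restrictRangePow {X : Type*} [NormedAddCommGroup X] [NormedSpace ℂ X]
    (T : X →L[ℂ] X) (n : ℕ) : (T ^ n).range →L[ℂ] (T ^ n).range :=
  T.restrict (p := (T ^ n).range) (q := (T ^ n).range)
    (by
      rintro _ ⟨x, rfl⟩
      refine ⟨T x, ?_⟩
      change (T ^ n * T) x = (T * T ^ n) x
      rw [← pow_succ, ← pow_succ'])

/-- A bounded operator `T` is a B-Fredholm operator if for some `n` the range of `T ^ n` is closed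
and the operator `T_n` that `T` induces on it is a Fredholm operator. -/
def IsBFredholmOperator {X : Type*} [NormedAddCommGroup X] [NormedSpace ℂ X]
    (T : X →L[ℂ] X) : Prop :=
  ∃ n : ℕ, IsClosed ((T ^ n).range : Set X) ∧ (restrictRangePow T n).IsFredholm

/-! Left multiplication `a ↦ leftMulOperator p a` is multiplicative and additive, and it sends the
socle to operators of finite rank: a minimal left ideal has the form `A p m`, and `(x p m)(y p) = x
(p m y p)` is a scalar multiple of `x p`. Hence the Drazin relations modulo the socle become
relations modulo finite rank for `T = leftMulOperator p a`. With `k` the Drazin exponent, these give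
generalized inverses of `T ^ k` and `T ^ (k + 1)`, hence closed ranges, and `T ^ (k + 1) B ≡ T ^ k ≡
B T ^ (k + 1)`, which bounds the cokernel and the kernel of `T` on `R(T ^ k)`. So `n = k` works. -/

theorem Submodule.FG.comap_subtype {K V : Type*} [Field K] [AddCommGroup V] [Module K V]
    {F : Submodule K V} (hF : F.FG) (S : Submodule K V) : (F.comap S.subtype).FG := by
  have : FiniteDimensional K F := Module.Finite.iff_fg.2 hF
  refine Submodule.fg_of_fg_map_injective S.subtype S.injective_subtype ?_
  exact Module.Finite.iff_fg.1 (Submodule.finiteDimensional_of_le (Submodule.map_comap_le _ F))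

/-- If `S C S` agrees with `S` up to an operator of finite rank, then `S` has closed range. -/
theorem isClosed_range_of_finite_range_sub {X : Type*} [NormedAddCommGroup X] [NormedSpace ℂ X]
    (S C : X →L[ℂ] X) (h : (S - S * C * S).range.FG) : IsClosed (S.range : Set X) := by
  have hco : (S - S * C * S).ker.CoFG := Submodule.range_fg_iff_ker_cofg.1 h
  refine LinearMap.isClosed_range_of_isClosed_map_of_finiteDimensional_quotient
    (s := (S - S * C * S).ker) ?_
  -- The kernel has finite codimension, so it suffices that its image is closed; that image is the
  -- fixed-point set of `S C`.
  have : ((S - S * C * S).ker.map (S : X →ₗ[ℂ] X) : Set X) = {y | S (C y) = y} := by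
    ext y
    constructor
    · rintro ⟨x, hx, rfl⟩
      exact (sub_eq_zero.1 hx).symm
    · intro hy
      have hy' : S (C y) = y := hy
      refine ⟨C y, ?_, hy⟩
      change S (C y) - S (C (S (C y))) = 0
      rw [hy', hy', sub_self]
  rw [this]
  exact isClosed_eq (S.continuous.comp C.continuous) continuous_id

/-- A bounded operator with closed range between Banach spaces is Fredholm if its kernel and its
cokernel have finite dimension. -/
theorem isFredholm_of_isClosed_range {Y Z : Type*}
    [NormedAddCommGroup Y] [NormedSpace ℂ Y] [CompleteSpace Y]
    [NormedAddCommGroup Z] [NormedSpace ℂ Z] [CompleteSpace Z]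
    (u : Y →L[ℂ] Z) (hcl : IsClosed (u.range : Set Z)) (hker : u.ker.FG) (hco : u.range.CoFG) :
    u.IsFredholm := by
  have hfin : FiniteDimensional ℂ u.ker := Module.Finite.iff_fg.2 hker
  refine ⟨?_, hcl, hfin, hco, .of_finiteDimensional _⟩
  have : CompleteSpace u.range := hcl.completeSpace_coe
  -- Strictness is the open mapping theorem onto the complete range.
  rw [Topology.isStrictMap_iff_isQuotientMap_rangeFactorization]
  exact (u.rangeRestrict.isOpenMap (LinearMap.surjective_rangeRestrict (u : Y →ₗ[ℂ] Z))).isQuotientMap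
    u.rangeRestrict.continuous (LinearMap.surjective_rangeRestrict (u : Y →ₗ[ℂ] Z))

/-- An operator on a Banach space is B-Fredholm if, up to operators of finite rank, `T ^ k` and
`T ^ (k + 1)` have generalized inverses and `T ^ k` is both a right and a left multiple of
`T ^ (k + 1)`. -/
theorem isBFredholmOperator_of_finite_range {X : Type*} [NormedAddCommGroup X] [NormedSpace ℂ X]
    [CompleteSpace X] (T B C D : X →L[ℂ] X) (k : ℕ)
    (hC : (T ^ k - T ^ k * C * T ^ k).range.FG)
    (hD : (T ^ (k + 1) - T ^ (k + 1) * D * T ^ (k + 1)).range.FG)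
    (hr : (T ^ k - T ^ (k + 1) * B).range.FG)
    (hl : (T ^ k - B * T ^ (k + 1)).range.FG) :
    IsBFredholmOperator T := by
  have hcl := isClosed_range_of_finite_range_sub _ _ hC
  have hcl' := isClosed_range_of_finite_range_sub _ _ hD
  have : CompleteSpace (T ^ k).range := hcl.completeSpace_coe
  have hTT (x : X) : T ((T ^ k) x) = (T ^ (k + 1)) x := by rw [pow_succ']; rfl
  refine ⟨k, hcl, isFredholm_of_isClosed_range _ ?_ ?_ ?_⟩
  · have : ((restrictRangePow T k).range : Set (T ^ k).range) =
        Subtype.val ⁻¹' ((T ^ (k + 1)).range : Set X) := by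
      ext y
      constructor
      · rintro ⟨⟨_, x, rfl⟩, rfl⟩
        exact ⟨x, (hTT x).symm⟩
      · rintro ⟨x, hx⟩
        exact ⟨⟨(T ^ k) x, x, rfl⟩, Subtype.ext ((hTT x).trans hx)⟩
    rw [this]
    exact hcl'.preimage continuous_subtype_val
  · have : FiniteDimensional ℂ ((T ^ k - B * T ^ (k + 1)).range.comap (T ^ k).range.subtype) :=
      Module.Finite.iff_fg.2 (hl.comap_subtype _)
    refine Module.Finite.iff_fg.1 (Submodule.finiteDimensional_of_le
      (S₂ := (T ^ k - B * T ^ (k + 1)).range.comap (T ^ k).range.subtype) ?_ :)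
    -- A kernel vector `T ^ k x` equals `(T ^ k - B T ^ (k + 1)) x`.
    rintro ⟨_, x, rfl⟩ hy
    have hx : (T ^ (k + 1)) x = 0 := (hTT x).symm.trans (congrArg Subtype.val hy)
    refine ⟨x, ?_⟩
    change (T ^ k) x - B ((T ^ (k + 1)) x) = (T ^ k) x
    rw [hx, map_zero, sub_zero]
  -- Split `T ^ k x = (T ^ k - T ^ (k + 1) B) x + T (T ^ k (B x))`.
  · refine Submodule.FG.cofg_of_codisjoint ?_ (hr.comap_subtype (T ^ k).range)
    rw [codisjoint_iff, eq_top_iff]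
    rintro ⟨_, x, rfl⟩ -
    have hmem : (T ^ k) x - (T ^ (k + 1)) (B x) ∈ (T ^ k).range :=
      sub_mem ⟨x, rfl⟩ ⟨T (B x), by rw [pow_succ]; rfl⟩
    refine Submodule.mem_sup.2 ⟨⟨_, hmem⟩, ⟨x, rfl⟩,
      restrictRangePow T k ⟨(T ^ k) (B x), B x, rfl⟩, ⟨_, rfl⟩, Subtype.ext ?_⟩
    change (T ^ k) x - (T ^ (k + 1)) (B x) + T ((T ^ k) (B x)) = (T ^ k) x
    rw [hTT, sub_add_cancel]

/-- In a primitive ring, a left ideal annihilated on the left by a nonzero element is zero. -/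
theorem IsPrimitiveRing.exists_mul_ne_zero {A : Type*} [Ring A] (hA : IsPrimitiveRing A) {p : A}
    (hp : p ≠ 0) {M : Ideal A} (hM : M ≠ ⊥) : ∃ m ∈ M, p * m ≠ 0 := by
  obtain ⟨L, hL, hfaith⟩ := hA
  by_contra! h
  obtain ⟨m, hmM, hm⟩ := Submodule.exists_mem_ne_zero_of_ne_bot hM
  obtain ⟨y, hy⟩ : ∃ y, m * y ∉ L := by
    by_contra! h'
    exact hm (hfaith m h')
  -- Maximality gives `1 = l + x m y` with `l ∈ L`; as `p` kills `M`, `p z = p z l ∈ L` for all `z`,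
  -- so `p = 0` by faithfulness.
  have htop : L ⊔ Ideal.span {m * y} = ⊤ :=
    hL.out.2 _ (lt_of_le_of_ne le_sup_left fun e => hy
      (e ▸ Ideal.mem_sup_right (Ideal.mem_span_singleton_self _)))
  obtain ⟨l, hl, w, hw, hlw⟩ := Submodule.mem_sup.1 ((Ideal.eq_top_iff_one _).1 htop)
  obtain ⟨x, rfl⟩ := Ideal.mem_span_singleton'.1 hw
  refine hp (hfaith p fun z => ?_)
  have hzero : p * (z * x * m) = 0 := h _ (M.mul_mem_left _ hmM)
  have : p * z = p * z * l := by
    calc p * z = p * z * (l + x * (m * y)) := by rw [hlw, mul_one]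
      _ = p * z * l + p * (z * x * m) * y := by noncomm_ring
      _ = p * z * l := by rw [hzero, zero_mul, add_zero]
  rw [this]
  exact L.mul_mem_left _ hl

section LeftMulOperator

variable {A : Type*} [NormedRing A] [NormedAlgebra ℂ A]

theorem coe_leftMulOperator_apply (p a : A) (y : leftIdealSpace p) :
    (leftMulOperator p a y : A) = a * y := rfl

theorem leftMulOperator_one (p : A) : leftMulOperator p 1 = 1 := by
  ext y
  simp [coe_leftMulOperator_apply]

theorem leftMulOperator_mul (p a b : A) :
    leftMulOperator p (a * b) = leftMulOperator p a * leftMulOperator p b := by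
  ext y
  simp [coe_leftMulOperator_apply, mul_assoc]

theorem leftMulOperator_add (p a b : A) :
    leftMulOperator p (a + b) = leftMulOperator p a + leftMulOperator p b := by
  ext y
  simp [coe_leftMulOperator_apply, add_mul]

theorem leftMulOperator_sub (p a b : A) :
    leftMulOperator p (a - b) = leftMulOperator p a - leftMulOperator p b := by
  ext y
  simp [coe_leftMulOperator_apply, sub_mul]

theorem leftMulOperator_pow (p a : A) (n : ℕ) :
    leftMulOperator p (a ^ n) = leftMulOperator p a ^ n := by
  induction n with
  | zero => rw [pow_zero, pow_zero, leftMulOperator_one]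
  | succ n ih => rw [pow_succ, pow_succ, leftMulOperator_mul, ih]

/-- For idempotent `p`, `A p` is the fixed-point set of `x ↦ x p`. -/
theorem isClosed_leftIdealSpace {p : A} (hp : p * p = p) :
    IsClosed (leftIdealSpace p : Set A) := by
  have : (leftIdealSpace p : Set A) = {x | x * p = x} := by
    ext x
    constructor
    · rintro ⟨y, rfl⟩
      exact (mul_assoc y p p).trans (congrArg (y * ·) hp)
    · intro hx
      exact ⟨x, hx⟩
  rw [this]
  exact isClosed_eq (by fun_prop) continuous_id

/-- In a primitive algebra, an element of a minimal left ideal acts on `A p`, for a minimal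
idempotent `p`, as an operator of finite rank. -/
theorem finite_range_leftMulOperator_of_mem_isAtom (hA : IsPrimitiveRing A) {p : A}
    (hp : IsMinimalIdempotent p) {M : Ideal A} (hM : IsAtom M) {s : A} (hs : s ∈ M) :
    (leftMulOperator p s).range.FG := by
  obtain ⟨m, hmM, hm⟩ := hA.exists_mul_ne_zero hp.1 hM.1
  have hspan : Ideal.span {p * m} = M := by
    refine (hM.le_iff.1 ?_).resolve_left ?_
    · exact (Ideal.span_singleton_le_iff_mem _).2 (M.mul_mem_left _ hmM)
    · simpa using hm
  obtain ⟨x, rfl⟩ := Ideal.mem_span_singleton'.1 (hspan ▸ hs)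
  let v : leftIdealSpace p := ⟨x * p, x, rfl⟩
  refine Module.Finite.iff_fg.1 (Submodule.finiteDimensional_of_le (S₂ := ℂ ∙ v) ?_ :)
  rintro _ ⟨⟨_, y, rfl⟩, rfl⟩
  obtain ⟨c, hc⟩ : p * (m * y) * p ∈ Set.range (fun c : ℂ => c • p) := hp.2.2 ▸ ⟨_, rfl⟩
  refine Submodule.mem_span_singleton.2 ⟨c, Subtype.ext ?_⟩
  change c • (x * p) = x * (p * m) * (y * p)
  calc c • (x * p) = x * (c • p) := (mul_smul_comm _ _ _).symm
    _ = x * (p * (m * y) * p) := congrArg (x * ·) hc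
    _ = x * (p * m) * (y * p) := by noncomm_ring

/-- In a primitive algebra, an element of the socle acts on `A p`, for a minimal idempotent `p`,
as an operator of finite rank. -/
theorem finite_range_leftMulOperator_of_mem_ringSocle (hA : IsPrimitiveRing A) {p : A}
    (hp : IsMinimalIdempotent p) {s : A} (hs : s ∈ ringSocle A) :
    (leftMulOperator p s).range.FG := by
  -- The elements acting with finite rank form a left ideal, so only minimal left ideals need
  -- checking.
  let F : Ideal A :=
    { carrier := {s | (leftMulOperator p s).range.FG}
      zero_mem' := by
        have : leftMulOperator p 0 = 0 := by
          ext y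
          simp [coe_leftMulOperator_apply]
        change (leftMulOperator p 0).range.FG
        rw [this]
        simp only [ContinuousLinearMap.toLinearMap_zero, LinearMap.range_zero, Submodule.fg_bot]
      add_mem' := by
        intro a b ha hb
        change (leftMulOperator p (a + b)).range.FG
        have := Module.Finite.iff_fg.2 (Submodule.FG.sup ha hb)
        rw [leftMulOperator_add]
        exact Module.Finite.iff_fg.1 (Submodule.finiteDimensional_of_le
          (LinearMap.range_add_le (leftMulOperator p a).toLinearMap
            (leftMulOperator p b).toLinearMap) :)
      smul_mem' := by
        intro c a ha
        change (leftMulOperator p (c * a)).range.FG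
        rw [leftMulOperator_mul]
        have := Submodule.FG.map (leftMulOperator p c).toLinearMap
          (N := (leftMulOperator p a).range) ha
        rwa [← LinearMap.range_comp] at this }
  exact (sSup_le fun M hM x hx =>
    finite_range_leftMulOperator_of_mem_isAtom hA hp hM hx : ringSocle A ≤ F) hs

end LeftMulOperator

/-- If `a` commutes with `b` and `a ^ k b a = a ^ k`, then `a ^ k b ^ j a ^ j = a ^ k`. -/
theorem pow_mul_pow_mul_pow_of_commute {R : Type*} [Monoid R] {a b : R} {k : ℕ}
    (hab : Commute a b) (h : a ^ k * b * a = a ^ k) (j : ℕ) : a ^ k * b ^ j * a ^ j = a ^ k := by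
  induction j with
  | zero => simp
  | succ j ih =>
    calc a ^ k * b ^ (j + 1) * a ^ (j + 1) = a ^ k * (b * b ^ j) * (a * a ^ j) := by
          rw [pow_succ' b, pow_succ' a]
      _ = a ^ k * b * (b ^ j * a) * a ^ j := by simp only [mul_assoc]
      _ = a ^ k * b * a * b ^ j * a ^ j := by
          rw [← (hab.pow_right j).eq]; simp only [mul_assoc]
      _ = a ^ k := by rw [h, ih]

theorem theorem3p2 {A : Type*} [NormedRing A] [NormedAlgebra ℂ A] [CompleteSpace A]
    (hA : IsPrimitiveRing A) (p : A) (hp : IsMinimalIdempotent p)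
    (a : A) (ha : IsBFredholmModulo (ringSocle A) a) :
    CompleteSpace (leftIdealSpace p) ∧ IsBFredholmOperator (leftMulOperator p a) := by
  have hcomp : CompleteSpace (leftIdealSpace p) :=
    (isClosed_leftIdealSpace hp.2.1).completeSpace_coe
  refine ⟨hcomp, ?_⟩
  obtain ⟨b', k, -, hab, hk⟩ := ha
  obtain ⟨b, rfl⟩ := Ideal.Quotient.mk_surjective b'
  set π := Ideal.Quotient.mk (ringSocle A)
  have hcomm : Commute (π a) (π b) := hab
  have hpow (j : ℕ) : π a ^ k * π b ^ j * π a ^ j = π a ^ k :=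
    pow_mul_pow_mul_pow_of_commute hcomm hk j
  have hfin {x y : A} (hxy : π x = π y) : (leftMulOperator p x - leftMulOperator p y).range.FG := by
    rw [← leftMulOperator_sub]
    exact finite_range_leftMulOperator_of_mem_ringSocle hA hp (Ideal.Quotient.eq.1 hxy)
  have hright : π a ^ (k + 1) * π b = π a ^ k := by
    rw [pow_succ, mul_assoc, hab, ← mul_assoc, hk]
  have hleft : π b * π a ^ (k + 1) = π a ^ k := by
    rw [← (hcomm.pow_left (k + 1)).eq, hright]
  -- Pull one `π a` out on the left and apply `hpow` with `j = k + 1`.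
  have hk' : π a ^ (k + 1) * π b ^ (k + 1) * π a ^ (k + 1) = π a ^ (k + 1) := by
    rw [pow_succ' (π a) k, mul_assoc, mul_assoc, ← pow_succ', ← mul_assoc (π a ^ k), hpow,
      ← pow_succ']
  have h₁ := hfin (x := a ^ k) (y := a ^ k * b ^ k * a ^ k) (by simp [hpow])
  have h₂ := hfin (x := a ^ (k + 1)) (y := a ^ (k + 1) * b ^ (k + 1) * a ^ (k + 1))
    (by simp only [map_mul, map_pow, hk'])
  have h₃ := hfin (x := a ^ k) (y := a ^ (k + 1) * b) (by simp only [map_mul, map_pow, hright])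
  have h₄ := hfin (x := a ^ k) (y := b * a ^ (k + 1)) (by simp only [map_mul, map_pow, hleft])
  simp only [leftMulOperator_mul, leftMulOperator_pow] at h₁ h₂ h₃ h₄
  exact isBFredholmOperator_of_finite_range _ _ _ _ k h₁ h₂ h₃ h₄
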